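/- For positive integers $m,n$ let $K_{m,n}$ be the complete bipartite graph with parts of sizes $m$ and $n$, and for a subgraph $G$ of $K_{m,n}$ (taken with all the vertices of $K_{m,n}$) let $\overline{G}$ be the graph on the same vertices whose edges are the edges of $K_{m,n}$ that are not in $G$. For bipartite graphs $H_1,H_2$, the $m$-bipartite Ramsey number $BR_m(H_1,H_2)$ is the least integer $n$ such that for every subgraph $G$ of $K_{m,n}$, either $G$ contains a (not necessarily induced) copy of $H_1$ or $\overline{G}$ contains a (not necessarily induced) copy of $H_2$. Theorem. The number $BR_8(K_{2,2},K_{4,4})$ exists and $$BR_8(K_{2,2},K_{4,4})=16 .$$ -/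

import Mathlib

open SimpleGraph

/-- `BipartiteArrows m n H₁ H₂`: every subgraph `G` of the complete bipartite graph `K_{m,n}`
contains a copy of `H₁`, or its complement inside `K_{m,n}` contains a copy of `H₂`.
Copies are not required to be induced. -/
def BipartiteArrows (m n : ℕ) {V W : Type*} (H₁ : SimpleGraph V) (H₂ : SimpleGraph W) : Prop :=
  ∀ G : SimpleGraph (Fin m ⊕ Fin n), G ≤ completeBipartiteGraph (Fin m) (Fin n) →
    H₁.IsContained G ∨ H₂.IsContained (completeBipartiteGraph (Fin m) (Fin n) \ G)

/-- `IsBipartiteRamseyNumber m H₁ H₂ r`: the `m`-bipartite Ramsey number `BR_m(H₁, H₂)` exists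
and equals `r`, that is, `r` is the least natural number `n` with `BipartiteArrows m n H₁ H₂`. -/
def IsBipartiteRamseyNumber (m : ℕ) {V W : Type*} (H₁ : SimpleGraph V) (H₂ : SimpleGraph W)
    (r : ℕ) : Prop :=
  IsLeast {n : ℕ | BipartiteArrows m n H₁ H₂} r

/-! Read each right vertex as its neighbourhood in the 8 left vertices. Avoiding `K_{2,2}` means
that the sets pairwise share at most one point; avoiding `K_{4,4}` in the complement means that no
four of them lie in a common 4-set. For the lower bound, 15 explicit sets have both properties.

Suppose 16 sets did, with F the pairs and K the sets of size at most 1. Counting ordered pairs of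
points gives 96 ≤ 56 + 4|F| + 6|K|. The graph with edge set F has no four-cycle and no triangle with
a pendant edge, either being four edges on four vertices; hence neighbour degrees sum to less than
the number of points, and Cauchy–Schwarz bounds |F| (`sq_two_mul_card_le`). Also |K| ≤ 3. If K is
nonempty, sharper bounds on |F| contradict the count (`avoid_or_extend`). If K is empty, then |F| =
10, every inequality is tight, and parity of degrees finishes
(`not_sparse_of_card_eq_two_or_three`). -/

/-! ### Degree sums in graphs without four-cycles -/

section NeighborSums

variable {V : Type*} [Fintype V] {G : SimpleGraph V} [DecidableRel G.Adj]

/-- In a graph in which every triangle is a component and which has no four-cycle, the degrees of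
the neighbours of a vertex sum to less than the number of vertices of the support. -/
theorem sum_degree_neighborFinset_lt [DecidableEq V]
    (hC4 : ∀ a b c d, a ≠ c → b ≠ d → G.Adj a b → G.Adj b c → G.Adj c d → G.Adj d a → False)
    (hpaw : ∀ a b c x, G.Adj a b → G.Adj b c → G.Adj c a → G.Adj a x → x ≠ b → x ≠ c → False)
    {U : Finset V} (hU : ∀ a b, G.Adj a b → a ∈ U) (hcard : 5 ≤ U.card) {v : V} (hv : v ∈ U) :
    ∑ w ∈ G.neighborFinset v, G.degree w < U.card := by
  by_cases htri : ∃ a b, G.Adj v a ∧ G.Adj a b ∧ G.Adj b v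
  · obtain ⟨a, b, hva, hab, hbv⟩ := htri
    have key : ∀ x y z, G.Adj x y → G.Adj y z → G.Adj z x → G.neighborFinset x ⊆ {y, z} := by
      intro x y z hxy hyz hzx t ht
      rw [mem_neighborFinset] at ht
      by_contra hne
      simp only [Finset.mem_insert, Finset.mem_singleton, not_or] at hne
      exact hpaw x y z t hxy hyz hzx ht hne.1 hne.2
    have hdeg : ∀ x y z, G.Adj x y → G.Adj y z → G.Adj z x → G.degree x ≤ 2 := fun x y z h1 h2 h3 =>
      (Finset.card_le_card (key x y z h1 h2 h3)).trans Finset.card_le_two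
    calc ∑ w ∈ G.neighborFinset v, G.degree w ≤ ∑ w ∈ ({a, b} : Finset V), G.degree w :=
          Finset.sum_le_sum_of_subset (key v a b hva hab hbv)
      _ = G.degree a + G.degree b := Finset.sum_pair hab.ne
      _ ≤ 2 + 2 := add_le_add (hdeg a b v hab hbv hva) (hdeg b v a hbv hva hab)
      _ < U.card := by omega
  · push Not at htri
    -- Off triangles, the sets N(w) \ {v} are disjoint from each other (no four-cycle) and from N(v)
    -- (no triangle), and all of them miss v, whence the strict inequality.
    have hdisj : (G.neighborFinset v : Set V).PairwiseDisjoint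
        fun w => (G.neighborFinset w).erase v := by
      intro w hw w' hw' hne
      simp only [coe_neighborFinset, mem_neighborSet] at hw hw'
      refine Finset.disjoint_left.2 fun x hx hx' => ?_
      simp only [Finset.mem_erase, mem_neighborFinset] at hx hx'
      exact hC4 v w x w' (Ne.symm hx.1) hne hw hx.2 hx'.2.symm hw'.symm
    have hdeg : ∀ w ∈ G.neighborFinset v,
        G.degree w = ((G.neighborFinset w).erase v).card + 1 := by
      intro w hw
      rw [mem_neighborFinset] at hw
      rw [Finset.card_erase_add_one (by simpa using hw.symm), card_neighborFinset_eq_degree]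
    rw [Finset.sum_congr rfl hdeg, Finset.sum_add_distrib, ← Finset.card_biUnion hdisj,
      Finset.sum_const, smul_eq_mul, mul_one, ← Finset.card_union_of_disjoint]
    · refine Finset.card_lt_card ((Finset.ssubset_iff_of_subset ?_).2 ⟨v, hv, ?_⟩)
      · intro x hx
        simp only [Finset.mem_union, Finset.mem_biUnion, Finset.mem_erase,
          mem_neighborFinset] at hx
        rcases hx with ⟨w, _, _, hwx⟩ | hvx
        · exact hU x w hwx.symm
        · exact hU x v hvx.symm
      · simp
    · refine Finset.disjoint_left.2 fun x hx hx' => ?_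
      simp only [Finset.mem_biUnion, Finset.mem_erase, mem_neighborFinset] at hx hx'
      obtain ⟨w, hvw, _, hwx⟩ := hx
      exact htri w x hvw hwx hx'.symm

theorem sum_sum_degree_neighborFinset :
    ∑ v, ∑ w ∈ G.neighborFinset v, G.degree w = ∑ w, G.degree w ^ 2 := by
  rw [Finset.sum_comm' (s' := fun w => G.neighborFinset w) (t' := Finset.univ)
    (by simp [adj_comm])]
  simp [sq]

/-- An edge bound for graphs without four-cycles in which every triangle is a component. -/
theorem sq_sum_degree_le [DecidableEq V]
    (hC4 : ∀ a b c d, a ≠ c → b ≠ d → G.Adj a b → G.Adj b c → G.Adj c d → G.Adj d a → False)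
    (hpaw : ∀ a b c x, G.Adj a b → G.Adj b c → G.Adj c a → G.Adj a x → x ≠ b → x ≠ c → False)
    {U : Finset V} (hU : ∀ a b, G.Adj a b → a ∈ U) (hcard : 5 ≤ U.card) :
    (∑ v, G.degree v) ^ 2 ≤ U.card ^ 2 * (U.card - 1) := by
  have hout : ∀ v ∉ U, G.neighborFinset v = ∅ := by
    intro v hv
    refine Finset.eq_empty_of_forall_notMem fun w hw => hv (hU v w ?_)
    simpa using hw
  have hdeg : ∀ v ∉ U, G.degree v = 0 := fun v hv => by
    rw [← card_neighborFinset_eq_degree, hout v hv, Finset.card_empty]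
  have h1 : ∑ v ∈ U, G.degree v = ∑ v, G.degree v :=
    Finset.sum_subset (Finset.subset_univ _) fun v _ hv => hdeg v hv
  have h2 : ∑ v ∈ U, G.degree v ^ 2 = ∑ v, G.degree v ^ 2 :=
    Finset.sum_subset (Finset.subset_univ _) fun v _ hv => by simp [hdeg v hv]
  have h3 : ∑ v ∈ U, ∑ w ∈ G.neighborFinset v, G.degree w =
      ∑ v, ∑ w ∈ G.neighborFinset v, G.degree w :=
    Finset.sum_subset (Finset.subset_univ _) fun v _ hv => by simp [hout v hv]
  have h4 : ∑ v ∈ U, ∑ w ∈ G.neighborFinset v, G.degree w ≤ U.card * (U.card - 1) := by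
    rw [← smul_eq_mul]
    exact Finset.sum_le_card_nsmul _ _ _ fun v hv =>
      Nat.le_sub_one_of_lt (sum_degree_neighborFinset_lt hC4 hpaw hU hcard hv)
  rw [h3, sum_sum_degree_neighborFinset, ← h2] at h4
  calc (∑ v, G.degree v) ^ 2 = (∑ v ∈ U, G.degree v) ^ 2 := by rw [h1]
    _ ≤ U.card * ∑ v ∈ U, G.degree v ^ 2 := sq_sum_le_card_mul_sum_sq
    _ ≤ U.card * (U.card * (U.card - 1)) := Nat.mul_le_mul_left _ h4
    _ = U.card ^ 2 * (U.card - 1) := by ring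

end NeighborSums

/-! ### The graph of two-element members -/

section SetFamilies

variable {ι V : Type*} [Fintype V] [DecidableEq V]

/-- The graph whose edges are the two-element members `c j`, `j ∈ F`, of a family of sets. -/
def pairGraph (c : ι → Finset V) (F : Finset ι) : SimpleGraph V where
  Adj a b := a ≠ b ∧ ∃ j ∈ F, c j = {a, b}
  symm := ⟨fun a b h => ⟨h.1.symm, by simpa only [Finset.pair_comm] using h.2⟩⟩
  loopless := ⟨fun _ h => h.1 rfl⟩

instance (c : ι → Finset V) (F : Finset ι) : DecidableRel (pairGraph c F).Adj :=
  fun _ _ => inferInstanceAs (Decidable (_ ∧ ∃ j ∈ F, _))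

variable {c : ι → Finset V} {F : Finset ι}

/-- Linearity prevents two indices from giving the same edge. -/
theorem degree_pairGraph (hlin : ∀ j k, j ≠ k → (c j ∩ c k).card ≤ 1)
    (hF : ∀ j ∈ F, (c j).card = 2) (v : V) :
    (pairGraph c F).degree v = (F.filter fun j => v ∈ c j).card := by
  have hnb : (pairGraph c F).neighborFinset v =
      (F.filter fun j => v ∈ c j).biUnion fun j => (c j).erase v := by
    ext w
    simp only [mem_neighborFinset, Finset.mem_biUnion, Finset.mem_filter, Finset.mem_erase]
    constructor
    · rintro ⟨hne, j, hj, hc⟩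
      exact ⟨j, ⟨hj, by simp [hc]⟩, hne.symm, by simp [hc]⟩
    · rintro ⟨j, ⟨hj, hv⟩, hne, hw⟩
      refine ⟨hne.symm, j, hj, (Finset.eq_of_subset_of_card_le ?_ ?_).symm⟩
      · simp [Finset.insert_subset_iff, hv, hw]
      · rw [hF j hj, Finset.card_pair hne.symm]
  rw [← card_neighborFinset_eq_degree, hnb, Finset.card_biUnion, Finset.card_eq_sum_ones]
  · refine Finset.sum_congr rfl fun j hj => ?_
    rw [Finset.mem_filter] at hj
    rw [Finset.card_erase_of_mem hj.2, hF j hj.1]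
  · intro j hj k hk hne
    replace hj := Finset.mem_filter.1 hj
    replace hk := Finset.mem_filter.1 hk
    refine Finset.disjoint_left.2 fun x hx hx' => ?_
    rw [Finset.mem_erase] at hx hx'
    have := Finset.card_le_one.1 (hlin j k hne) x (by simp [hx.2, hx'.2]) v (by simp [hj.2, hk.2])
    exact hx.1 this

theorem sum_degree_pairGraph (hlin : ∀ j k, j ≠ k → (c j ∩ c k).card ≤ 1)
    (hF : ∀ j ∈ F, (c j).card = 2) :
    ∑ v, (pairGraph c F).degree v = 2 * F.card := by
  simp only [degree_pairGraph hlin hF]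
  have := Finset.sum_card_bipartiteAbove_eq_sum_card_bipartiteBelow (s := Finset.univ) (t := F)
    (fun (v : V) j => v ∈ c j)
  simp only [Finset.bipartiteAbove, Finset.bipartiteBelow, Finset.filter_univ_mem] at this
  rw [this, Finset.sum_congr rfl hF, Finset.sum_const, smul_eq_mul, mul_comm]

end SetFamilies

/-! ### Counting pairs of points in a linear family -/

section Counting

variable {ι V : Type*} [Fintype ι] [DecidableEq V] [Fintype V] {c : ι → Finset V}

/-- Sets through v become disjoint once v is removed. -/
theorem sum_card_sub_one_le (hlin : ∀ j k, j ≠ k → (c j ∩ c k).card ≤ 1) (v : V) :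
    ∑ j with v ∈ c j, ((c j).card - 1) ≤ Fintype.card V - 1 := by
  have h : ∀ j ∈ Finset.univ.filter (fun j => v ∈ c j), (c j).card - 1 = ((c j).erase v).card :=
    fun j hj => (Finset.card_erase_of_mem (Finset.mem_filter.1 hj).2).symm
  rw [Finset.sum_congr rfl h, ← Finset.card_biUnion, ← Finset.card_univ,
    ← Finset.card_erase_of_mem (Finset.mem_univ v)]
  · refine Finset.card_le_card (Finset.biUnion_subset.2 fun j _ => ?_)
    exact Finset.erase_subset_erase _ (Finset.subset_univ _)
  · intro j hj k hk hne
    replace hj := Finset.mem_filter.1 hj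
    replace hk := Finset.mem_filter.1 hk
    refine Finset.disjoint_left.2 fun x hx hx' => ?_
    rw [Finset.mem_erase] at hx hx'
    exact hx.1 (Finset.card_le_one.1 (hlin j k hne) x (by simp [hx.2, hx'.2]) v
      (by simp [hj.2, hk.2]))

theorem sum_sum_card_sub_one :
    ∑ v, ∑ j with v ∈ c j, ((c j).card - 1) = ∑ j, (c j).card * ((c j).card - 1) := by
  rw [Finset.sum_comm' (s' := fun j => c j) (t' := Finset.univ) (by simp)]
  simp

end Counting

/-! ### Sparse linear families on eight points -/

section SparseFamilies

variable {ι V : Type*} [DecidableEq ι] [DecidableEq V] {c : ι → Finset V} {F : Finset ι}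

theorem no_four_sets (hsp : ∀ J : Finset ι, (J.biUnion c).card ≤ 4 → J.card ≤ 3)
    {S : Finset V} (hS : S.card ≤ 4) {j₁ j₂ j₃ j₄ : ι} (h12 : j₁ ≠ j₂)
    (h13 : j₁ ≠ j₃) (h14 : j₁ ≠ j₄) (h23 : j₂ ≠ j₃) (h24 : j₂ ≠ j₄) (h34 : j₃ ≠ j₄)
    (h1 : c j₁ ⊆ S) (h2 : c j₂ ⊆ S) (h3 : c j₃ ⊆ S) (h4 : c j₄ ⊆ S) : False := by
  have hcard : ({j₁, j₂, j₃, j₄} : Finset ι).card = 4 := by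
    rw [Finset.card_insert_of_notMem (by simp [*]), Finset.card_insert_of_notMem (by simp [*]),
      Finset.card_pair h34]
  have := hsp {j₁, j₂, j₃, j₄} ((Finset.card_le_card (Finset.biUnion_subset.2 ?_)).trans hS)
  · omega
  · simp [h1, h2, h3, h4]

theorem pairGraph_no_four_cycle [Fintype V]
    (hsp : ∀ J : Finset ι, (J.biUnion c).card ≤ 4 → J.card ≤ 3)
    (x y z t : V) (hxz : x ≠ z) (hyt : y ≠ t) (h1 : (pairGraph c F).Adj x y)
    (h2 : (pairGraph c F).Adj y z) (h3 : (pairGraph c F).Adj z t)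
    (h4 : (pairGraph c F).Adj t x) : False := by
  obtain ⟨hxy, j₁, -, e1⟩ := h1
  obtain ⟨hyz, j₂, -, e2⟩ := h2
  obtain ⟨hzt, j₃, -, e3⟩ := h3
  obtain ⟨htx, j₄, -, e4⟩ := h4
  -- Indices are told apart by a vertex lying in one edge but not in the other.
  have ne : ∀ (j k : ι) (v : V), v ∈ c j → v ∉ c k → j ≠ k := by
    rintro j k v hj hk rfl
    exact hk hj
  refine no_four_sets hsp (S := {x, y, z, t}) Finset.card_le_four
    (ne j₁ j₂ x ?_ ?_) (ne j₁ j₃ x ?_ ?_) (ne j₁ j₄ y ?_ ?_) (ne j₂ j₃ y ?_ ?_) (ne j₂ j₄ y ?_ ?_)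
    (ne j₃ j₄ z ?_ ?_) ?_ ?_ ?_ ?_ <;>
  simp [e1, e2, e3, e4, Finset.insert_subset_iff, hxy, hxz, hyz, hyt, hzt, htx.symm, hxy.symm,
    hxz.symm, hyz.symm]

theorem pairGraph_no_paw [Fintype V]
    (hsp : ∀ J : Finset ι, (J.biUnion c).card ≤ 4 → J.card ≤ 3)
    (x y z t : V) (h1 : (pairGraph c F).Adj x y)
    (h2 : (pairGraph c F).Adj y z) (h3 : (pairGraph c F).Adj z x)
    (h4 : (pairGraph c F).Adj x t) (hty : t ≠ y) (htz : t ≠ z) : False := by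
  obtain ⟨hxy, j₁, -, e1⟩ := h1
  obtain ⟨hyz, j₂, -, e2⟩ := h2
  obtain ⟨hzx, j₃, -, e3⟩ := h3
  obtain ⟨hxt, j₄, -, e4⟩ := h4
  have ne : ∀ (j k : ι) (v : V), v ∈ c j → v ∉ c k → j ≠ k := by
    rintro j k v hj hk rfl
    exact hk hj
  refine no_four_sets hsp (S := {x, y, z, t}) Finset.card_le_four
    (ne j₁ j₂ x ?_ ?_) (ne j₁ j₃ y ?_ ?_) (ne j₁ j₄ y ?_ ?_) (ne j₂ j₃ y ?_ ?_) (ne j₂ j₄ y ?_ ?_)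
    (ne j₃ j₄ z ?_ ?_) ?_ ?_ ?_ ?_ <;>
  simp [e1, e2, e3, e4, Finset.insert_subset_iff, hxy, hyz, hzx.symm, hxt, hty, htz, hxy.symm,
    hty.symm, htz.symm, hyz.symm, hzx]

variable [Fintype V]

/-- For |U| = 8, 7, 6, 5 this gives |F| ≤ 10, 8, 6, 5. -/
theorem sq_two_mul_card_le (hlin : ∀ j k, j ≠ k → (c j ∩ c k).card ≤ 1)
    (hsp : ∀ J : Finset ι, (J.biUnion c).card ≤ 4 → J.card ≤ 3)
    (hF : ∀ j ∈ F, (c j).card = 2) {U : Finset V} (hU : ∀ j ∈ F, c j ⊆ U) (hcard : 5 ≤ U.card) :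
    (2 * F.card) ^ 2 ≤ U.card ^ 2 * (U.card - 1) := by
  rw [← sum_degree_pairGraph hlin hF]
  refine sq_sum_degree_le (pairGraph_no_four_cycle hsp) (pairGraph_no_paw hsp) ?_ hcard
  rintro a b ⟨-, j, hj, hc⟩
  exact hU j hj (by simp [hc])

/-- Either all pairs of the family outside `J` avoid a set of `q` points that contains the `q`
members indexed by `J`, or a further pair can be added to `J` at the cost of one more point. -/
theorem avoid_or_extend (hF : ∀ j ∈ F, (c j).card = 2) {q : ℕ} (hq : q ≤ Fintype.card V)
    {Q : Finset V} (hQ : Q.card ≤ q) {J : Finset ι} (hJQ : ∀ j ∈ J, c j ⊆ Q) :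
    (∃ U : Finset V, U.card = Fintype.card V - q ∧ ∀ j ∈ F \ J, c j ⊆ U) ∨
      ∃ j ∈ F \ J, ∃ Q' : Finset V, Q'.card ≤ q + 1 ∧ ∀ k ∈ insert j J, c k ⊆ Q' := by
  -- Padding Q to exactly q points makes the complement have the required size; a pair meeting T
  -- adds at most one point to it.
  obtain ⟨T, hQT, hT⟩ := Finset.exists_superset_card_eq hQ hq
  by_cases h : ∀ j ∈ F \ J, c j ⊆ Tᶜ
  · exact Or.inl ⟨Tᶜ, by rw [Finset.card_compl, hT], h⟩
  · push Not at h
    obtain ⟨j, hj, hjT⟩ := h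
    obtain ⟨x, hx, hxT⟩ := Finset.not_subset.1 hjT
    rw [Finset.mem_compl, not_not] at hxT
    refine Or.inr ⟨j, hj, T ∪ c j, ?_, fun k hk => ?_⟩
    · have h2 := Finset.card_union_add_card_inter T (c j)
      have h3 : 0 < (T ∩ c j).card := Finset.card_pos.2 ⟨x, by simp [hxT, hx]⟩
      have h4 := hF j (Finset.mem_sdiff.1 hj).1
      omega
    · rcases Finset.mem_insert.1 hk with rfl | hk
      · exact Finset.subset_union_right
      · exact ((hJQ k hk).trans hQT).trans Finset.subset_union_left

/-- Extending J would put four sets in four points, so the remaining pairs live on five points. -/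
theorem card_sdiff_le_of_three (hV : Fintype.card V = 8)
    (hlin : ∀ j k, j ≠ k → (c j ∩ c k).card ≤ 1)
    (hsp : ∀ J : Finset ι, (J.biUnion c).card ≤ 4 → J.card ≤ 3)
    (hF : ∀ j ∈ F, (c j).card = 2) {Q : Finset V} (hQ : Q.card ≤ 3) {J : Finset ι}
    (hJ : J.card = 3) (hJQ : ∀ j ∈ J, c j ⊆ Q) : (F \ J).card ≤ 5 := by
  rcases avoid_or_extend hF (by omega) hQ hJQ with ⟨U, hU, hFU⟩ | ⟨j, hj, Q', hQ', hJQ'⟩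
  · have h := sq_two_mul_card_le hlin hsp (fun j hj => hF j (Finset.mem_sdiff.1 hj).1) hFU
      (by omega)
    rw [hU, hV] at h
    nlinarith
  · have := hsp _ ((Finset.card_le_card (Finset.biUnion_subset.2 hJQ')).trans hQ')
    rw [Finset.card_insert_of_notMem (Finset.mem_sdiff.1 hj).2] at this
    omega

theorem card_sdiff_le_add_one {j : ι} {J : Finset ι} :
    (F \ J).card ≤ (F \ insert j J).card + 1 := by
  rw [Finset.sdiff_insert]
  exact Nat.le_add_of_sub_le Finset.pred_card_le_card_erase

/-- Either the remaining pairs live on six points, or one of them joins J and the case of three sets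
leaves at most 5 others. -/
theorem card_sdiff_le_of_two (hV : Fintype.card V = 8)
    (hlin : ∀ j k, j ≠ k → (c j ∩ c k).card ≤ 1)
    (hsp : ∀ J : Finset ι, (J.biUnion c).card ≤ 4 → J.card ≤ 3)
    (hF : ∀ j ∈ F, (c j).card = 2) {Q : Finset V} (hQ : Q.card ≤ 2) {J : Finset ι}
    (hJ : J.card = 2) (hJQ : ∀ j ∈ J, c j ⊆ Q) : (F \ J).card ≤ 6 := by
  rcases avoid_or_extend hF (by omega) hQ hJQ with ⟨U, hU, hFU⟩ | ⟨j, hj, Q', hQ', hJQ'⟩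
  · have h := sq_two_mul_card_le hlin hsp (fun j hj => hF j (Finset.mem_sdiff.1 hj).1) hFU
      (by omega)
    rw [hU, hV] at h
    nlinarith
  · have h := card_sdiff_le_of_three hV hlin hsp hF hQ'
      (by rw [Finset.card_insert_of_notMem (Finset.mem_sdiff.1 hj).2, hJ]) hJQ'
    exact card_sdiff_le_add_one.trans (Nat.succ_le_succ h)

theorem card_sdiff_le_of_one (hV : Fintype.card V = 8)
    (hlin : ∀ j k, j ≠ k → (c j ∩ c k).card ≤ 1)
    (hsp : ∀ J : Finset ι, (J.biUnion c).card ≤ 4 → J.card ≤ 3)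
    (hF : ∀ j ∈ F, (c j).card = 2) {Q : Finset V} (hQ : Q.card ≤ 1) {J : Finset ι}
    (hJ : J.card = 1) (hJQ : ∀ j ∈ J, c j ⊆ Q) : (F \ J).card ≤ 8 := by
  rcases avoid_or_extend hF (by omega) hQ hJQ with ⟨U, hU, hFU⟩ | ⟨j, hj, Q', hQ', hJQ'⟩
  · have h := sq_two_mul_card_le hlin hsp (fun j hj => hF j (Finset.mem_sdiff.1 hj).1) hFU
      (by omega)
    rw [hU, hV] at h
    nlinarith
  · have h := card_sdiff_le_of_two hV hlin hsp hF hQ'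
      (by rw [Finset.card_insert_of_notMem (Finset.mem_sdiff.1 hj).2, hJ]) hJQ'
    have := card_sdiff_le_add_one (F := F) (j := j) (J := J)
    omega

variable [Fintype ι]

/-- The pair graph of a linear family of sixteen sets of sizes two and three that covers all pairs
of an eight-element set cannot be sparse. -/
theorem not_sparse_of_card_eq_two_or_three (hV : Fintype.card V = 8)
    (hlin : ∀ j k, j ≠ k → (c j ∩ c k).card ≤ 1)
    (hsp : ∀ J : Finset ι, (J.biUnion c).card ≤ 4 → J.card ≤ 3)
    (hF : F = Finset.univ.filter fun j => (c j).card = 2) (hF10 : F.card = 10)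
    (h23 : ∀ j, (c j).card = 2 ∨ (c j).card = 3)
    (hcov : ∀ v, ∑ j with v ∈ c j, ((c j).card - 1) = 7) : False := by
  have hF2 : ∀ j ∈ F, (c j).card = 2 := by simp [hF]
  let G := pairGraph c F
  have hdeg : ∀ v, G.degree v = (F.filter fun j => v ∈ c j).card := degree_pairGraph hlin hF2
  -- The 7 other points are split among the sets through v, a triple taking two and a pair one, so
  -- the number of pairs at v is odd.
  have hodd : ∀ v, Odd (G.degree v) := by
    intro v
    have h1 : ∑ j with v ∈ c j, ((c j).card - 1) + ∑ j with v ∈ c j, (if (c j).card = 2 then 1 else 0)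
        = ∑ j with v ∈ c j, 2 := by
      rw [← Finset.sum_add_distrib]
      refine Finset.sum_congr rfl fun j _ => ?_
      rcases h23 j with h | h <;> simp [h]
    rw [hcov, ← Finset.card_filter, Finset.filter_comm, ← hF, ← hdeg,
      Finset.sum_const, smul_eq_mul] at h1
    rw [Nat.odd_iff]
    omega
  have hS : ∀ v, ∑ w ∈ G.neighborFinset v, G.degree w ≤ 7 := by
    intro v
    have := sum_degree_neighborFinset_lt (pairGraph_no_four_cycle hsp) (pairGraph_no_paw hsp)
      (G := G) (U := Finset.univ) (by simp) (by rw [Finset.card_univ, hV]; norm_num)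
      (Finset.mem_univ v)
    rw [Finset.card_univ, hV] at this
    omega
  have hsum : ∑ v, G.degree v = 20 :=
    (sum_degree_pairGraph hlin hF2).trans (by rw [hF10])
  -- This is (d - 1)(d - 3) ≥ 0, valid for odd d.
  have hquad : ∀ v ∈ Finset.univ, 4 * G.degree v ≤ G.degree v ^ 2 + 3 := by
    intro v _
    obtain ⟨m, hm⟩ := hodd v
    rw [hm]
    rcases m with _ | m
    · norm_num
    · nlinarith
  have hsq := sum_sum_degree_neighborFinset (G := G)
  have h1 := Finset.sum_le_sum hquad
  have h2 := Finset.sum_le_sum fun v (_ : v ∈ Finset.univ) => hS v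
  have hc : ∑ _v : V, 3 = 24 := by simp [hV]
  have hc' : ∑ _v : V, 7 = 56 := by simp [hV]
  rw [hc'] at h2
  rw [← Finset.mul_sum, hsum, Finset.sum_add_distrib, hc] at h1
  -- The sum of squared degrees is at least 4 · 20 - 24 = 56 and at most 8 · 7 = 56, so both
  -- termwise bounds are equalities.
  have hSeq : ∀ v, ∑ w ∈ G.neighborFinset v, G.degree w = 7 := fun v =>
    (Finset.sum_eq_sum_iff_of_le fun v _ => hS v).1 (by omega) v (Finset.mem_univ v)
  have hqeq : ∀ v, 4 * G.degree v = G.degree v ^ 2 + 3 := fun v =>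
    (Finset.sum_eq_sum_iff_of_le hquad).1
      (by rw [← Finset.mul_sum, hsum, Finset.sum_add_distrib, hc]; omega) v (Finset.mem_univ v)
  have h13 : ∀ v, G.degree v = 1 ∨ G.degree v = 3 := by
    intro v
    have h := hqeq v
    have : G.degree v ≤ 3 := by nlinarith
    interval_cases G.degree v <;> simp_all
  -- The only neighbour of a vertex of degree 1 would have degree 7; if all degrees are 3, they sum
  -- to 24 instead of 20.
  by_cases h : ∃ v, G.degree v = 1
  · obtain ⟨v, hv⟩ := h
    rw [← card_neighborFinset_eq_degree, Finset.card_eq_one] at hv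
    obtain ⟨w, hw⟩ := hv
    have := hSeq v
    rw [hw, Finset.sum_singleton] at this
    have := h13 w
    omega
  · push Not at h
    have h3 : ∀ v ∈ Finset.univ, G.degree v = 3 := fun v _ => (h13 v).resolve_left (h v)
    rw [Finset.sum_congr rfl h3, hc] at hsum
    omega

/-- Among sixteen subsets of an eight-element set that pairwise meet in at most one point, some
four lie in a common four-element set. -/
theorem not_sparse_of_linear (hV : Fintype.card V = 8) (hι : Fintype.card ι = 16)
    (hlin : ∀ j k, j ≠ k → (c j ∩ c k).card ≤ 1)
    (hsp : ∀ J : Finset ι, (J.biUnion c).card ≤ 4 → J.card ≤ 3) : False := by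
  set F := Finset.univ.filter fun j => (c j).card = 2 with hF
  set K := Finset.univ.filter fun j => (c j).card ≤ 1 with hK
  have hF2 : ∀ j ∈ F, (c j).card = 2 := by simp [hF]
  have hK1 : ∀ j ∈ K, (c j).card ≤ 1 := by simp [hK]
  have hFK : Disjoint F K := Finset.disjoint_left.2 fun j hj hj' => by
    have := hF2 j hj
    have := hK1 j hj'
    omega
  have hloc : ∀ v ∈ Finset.univ, ∑ j with v ∈ c j, ((c j).card - 1) ≤ 7 := fun v _ => by
    simpa [hV] using sum_card_sub_one_le hlin v
  -- A set of size at least 3 has at least 6 ordered pairs; a pair falls short by 4, a smaller set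
  -- by 6.
  have hpt : ∀ j ∈ Finset.univ, 6 ≤ (c j).card * ((c j).card - 1) +
      (if (c j).card = 2 then 1 else 0) * 4 + (if (c j).card ≤ 1 then 1 else 0) * 6 := by
    intro j _
    rcases h : (c j).card with _ | _ | _ | m
    · simp
    · simp
    · simp
    · rw [show m + 1 + 1 + 1 - 1 = m + 2 by omega]
      nlinarith [Nat.zero_le ((if m + 1 + 1 + 1 = 2 then 1 else 0) * 4),
        Nat.zero_le ((if m + 1 + 1 + 1 ≤ 1 then 1 else 0) * 6)]
  have hpairs : ∑ j, (c j).card * ((c j).card - 1) ≤ 56 := by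
    rw [← sum_sum_card_sub_one]
    simpa [hV] using Finset.sum_le_sum hloc
  have hsplit : ∑ j, ((c j).card * ((c j).card - 1) + (if (c j).card = 2 then 1 else 0) * 4 +
      (if (c j).card ≤ 1 then 1 else 0) * 6) =
      ∑ j, (c j).card * ((c j).card - 1) + F.card * 4 + K.card * 6 := by
    rw [Finset.sum_add_distrib, Finset.sum_add_distrib, ← Finset.sum_mul, ← Finset.sum_mul,
      ← Finset.card_filter, ← Finset.card_filter]
  have h96 : ∑ _j : ι, 6 = 96 := by simp [hι]
  have hcount := Finset.sum_le_sum hpt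
  rw [hsplit, h96] at hcount
  have hKu : ∀ L ⊆ K, (L.biUnion c).card ≤ L.card := fun L hL => by
    simpa using Finset.card_biUnion_le_card_mul L c 1 fun j hj => hK1 j (hL hj)
  have hK3 : K.card ≤ 3 := by
    by_contra hlt
    obtain ⟨L, hLK, hL⟩ := Finset.exists_subset_card_eq (s := K) (n := 4) (by omega)
    have := hsp L ((hKu L hLK).trans hL.le)
    omega
  have hF10 : F.card ≤ 10 := by
    have := sq_two_mul_card_le hlin hsp hF2 (U := Finset.univ) (by simp)
      (by rw [Finset.card_univ, hV]; norm_num)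
    rw [Finset.card_univ, hV] at this
    nlinarith
  by_cases hK0 : K.card = 0
  · have hF10' : F.card = 10 := by omega
    have hKe : ∀ j, ¬ (c j).card ≤ 1 := fun j hj => by
      have : j ∈ K := by simp [hK, hj]
      rw [Finset.card_eq_zero.1 hK0] at this
      simp at this
    refine not_sparse_of_card_eq_two_or_three hV hlin hsp hF hF10' (fun j => ?_) fun v => ?_
    · have h := (Finset.sum_eq_sum_iff_of_le hpt).1 (by rw [hsplit, h96]; omega) j
        (Finset.mem_univ j)
      have h1 := hKe j
      by_contra hne
      push Not at hne
      rw [if_neg hne.1, if_neg h1] at h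
      obtain ⟨m, hm⟩ : ∃ m, (c j).card = m + 4 := ⟨(c j).card - 4, by omega⟩
      rw [hm, show m + 4 - 1 = m + 3 by omega] at h
      nlinarith
    · refine (Finset.sum_eq_sum_iff_of_le hloc).1 ?_ v (Finset.mem_univ v)
      rw [sum_sum_card_sub_one]
      simp only [Finset.sum_const, Finset.card_univ, hV, smul_eq_mul]
      omega
  · have hQ := hKu K Finset.Subset.rfl
    have hKQ : ∀ j ∈ K, c j ⊆ K.biUnion c := fun j hj => Finset.subset_biUnion_of_mem c hj
    have hsd : F \ K = F := Finset.sdiff_eq_self_of_disjoint hFK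
    -- The count forces |F| ≥ 9, 7, 6 for |K| = 1, 2, 3, against the upper bounds 8, 6, 5.
    obtain hk | hk | hk : K.card = 1 ∨ K.card = 2 ∨ K.card = 3 := by omega
    · have := card_sdiff_le_of_one hV hlin hsp hF2 (hQ.trans hk.le) hk hKQ
      rw [hsd] at this
      omega
    · have := card_sdiff_le_of_two hV hlin hsp hF2 (hQ.trans hk.le) hk hKQ
      rw [hsd] at this
      omega
    · have := card_sdiff_le_of_three hV hlin hsp hF2 (hQ.trans hk.le) hk hKQ
      rw [hsd] at this
      omega

end SparseFamilies

/-! ### Translation between graphs and set families; the lower bound -/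

section BipartiteCopies

variable {m n a b : ℕ} {G : SimpleGraph (Fin m ⊕ Fin n)}

theorem completeBipartiteGraph_isContained (f : Fin a ↪ Fin m) (g : Fin b ↪ Fin n)
    (h : ∀ i j, G.Adj (.inl (f i)) (.inr (g j))) :
    (completeBipartiteGraph (Fin a) (Fin b)).IsContained G := by
  refine ⟨⟨⟨Sum.map f g, ?_⟩, f.injective.sumMap g.injective⟩⟩
  rintro (x | x) (y | y) hxy
  · simp [completeBipartiteGraph] at hxy
  · exact h x y
  · exact (h y x).symm
  · simp [completeBipartiteGraph] at hxy

/-- In a bipartite graph, a copy of a balanced complete bipartite graph respects the two sides, up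
to exchanging its own sides. -/
theorem exists_embeddings_of_isContained (ha : 0 < a)
    (hG : G ≤ completeBipartiteGraph (Fin m) (Fin n))
    (h : (completeBipartiteGraph (Fin a) (Fin a)).IsContained G) :
    ∃ (f : Fin a ↪ Fin m) (g : Fin a ↪ Fin n), ∀ i j, G.Adj (.inl (f i)) (.inr (g j)) := by
  obtain ⟨φ⟩ := h
  have hadj : ∀ i j : Fin a, G.Adj (φ (.inl i)) (φ (.inr j)) := fun i j =>
    φ.toHom.map_adj (by simp [completeBipartiteGraph])
  have hinj : Function.Injective φ := φ.injective
  have hl : ∀ x y, G.Adj (.inl x) y → ∃ z, y = .inr z := by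
    rintro x (y | y) hxy
    · simpa [completeBipartiteGraph] using hG hxy
    · exact ⟨y, rfl⟩
  have hr : ∀ x y, G.Adj (.inr x) y → ∃ z, y = .inl z := by
    rintro x (y | y) hxy
    · exact ⟨y, rfl⟩
    · simpa [completeBipartiteGraph] using hG hxy
  -- The side receiving one vertex determines the side of every other.
  rcases h0 : φ (.inl ⟨0, ha⟩) with x | x
  · choose g hg using fun j => hl x _ (h0 ▸ hadj ⟨0, ha⟩ j)
    choose f hf using fun i => hr (g ⟨0, ha⟩) _ (hg ⟨0, ha⟩ ▸ (hadj i ⟨0, ha⟩).symm)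
    refine ⟨⟨f, fun i j hij => ?_⟩, ⟨g, fun i j hij => ?_⟩, fun i j => ?_⟩
    · exact Sum.inl_injective (hinj ((hf i).trans (hij ▸ (hf j).symm)))
    · exact Sum.inr_injective (hinj ((hg i).trans (hij ▸ (hg j).symm)))
    · exact hf i ▸ hg j ▸ hadj i j
  · choose g hg using fun j => hr x _ (h0 ▸ hadj ⟨0, ha⟩ j)
    choose f hf using fun i => hl (g ⟨0, ha⟩) _ (hg ⟨0, ha⟩ ▸ (hadj i ⟨0, ha⟩).symm)
    refine ⟨⟨g, fun i j hij => ?_⟩, ⟨f, fun i j hij => ?_⟩, fun i j => ?_⟩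
    · exact Sum.inr_injective (hinj ((hg i).trans (hij ▸ (hg j).symm)))
    · exact Sum.inl_injective (hinj ((hf i).trans (hij ▸ (hf j).symm)))
    · exact (hf j ▸ hg i ▸ hadj j i).symm

/-- The bipartite graph in which the right vertex `j` is joined to the members of `c j`. -/
def incidenceBipartiteGraph (c : Fin n → Finset (Fin m)) : SimpleGraph (Fin m ⊕ Fin n) where
  Adj
    | .inl i, .inr j => i ∈ c j
    | .inr j, .inl i => i ∈ c j
    | _, _ => False
  symm := ⟨by rintro (x | x) (y | y) h <;> exact h⟩
  loopless := ⟨by rintro (x | x) h <;> exact h⟩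

theorem incidenceBipartiteGraph_le (c : Fin n → Finset (Fin m)) :
    incidenceBipartiteGraph c ≤ completeBipartiteGraph (Fin m) (Fin n) := by
  rintro (x | x) (y | y) h
  · exact h.elim
  · simp [completeBipartiteGraph]
  · simp [completeBipartiteGraph]
  · exact h.elim

/-- Fifteen subsets of an eight-element set that form a sparse linear family. -/
def extremalFamily : Fin 15 → Finset (Fin 8) :=
  ![{4, 6, 7}, {3, 7}, {5, 7}, {5, 6}, {0, 6}, {1, 5}, {0, 1, 2}, {0, 4, 5}, {2, 6}, {1, 3, 6},
    {3, 4}, {2, 4}, {2, 3, 5}, {1, 4}, {0, 3}]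

theorem card_inter_extremalFamily_le :
    ∀ j k, j ≠ k → (extremalFamily j ∩ extremalFamily k).card ≤ 1 := by
  decide +kernel

/-- Sparsity in complementary form: S is the left side of a potential `K_{4,4}` in the complement.
-/
theorem card_disjoint_extremalFamily_le :
    ∀ S ∈ Finset.powersetCard 4 (Finset.univ : Finset (Fin 8)),
      (Finset.univ.filter fun j => Disjoint S (extremalFamily j)).card ≤ 3 := by
  decide +kernel

theorem not_bipartiteArrows_of_lt (hn : n < 16) :
    ¬ BipartiteArrows 8 n (completeBipartiteGraph (Fin 2) (Fin 2))
      (completeBipartiteGraph (Fin 4) (Fin 4)) := by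
  intro h
  have hn' : n ≤ 15 := by omega
  let e : Fin n ↪ Fin 15 := Fin.castLEEmb hn'
  have hle := incidenceBipartiteGraph_le fun j => extremalFamily (e j)
  rcases h _ hle with h | h
  · obtain ⟨f, g, hfg⟩ := exists_embeddings_of_isContained (by norm_num) hle h
    have hne : e (g 0) ≠ e (g 1) := by simp
    have := Finset.card_le_one.1 (card_inter_extremalFamily_le _ _ hne) (f 0)
      (Finset.mem_inter.2 ⟨hfg 0 0, hfg 0 1⟩) (f 1) (Finset.mem_inter.2 ⟨hfg 1 0, hfg 1 1⟩)
    simp at this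
  · obtain ⟨f, g, hfg⟩ := exists_embeddings_of_isContained (by norm_num) sdiff_le h
    have h1 := card_disjoint_extremalFamily_le (Finset.univ.map f) (by simp)
    have h2 : Finset.univ.map (g.trans e) ⊆
        Finset.univ.filter fun j => Disjoint (Finset.univ.map f) (extremalFamily j) := by
      intro x hx
      obtain ⟨j, -, rfl⟩ := Finset.mem_map.1 hx
      rw [Finset.mem_filter]
      refine ⟨Finset.mem_univ _, Finset.disjoint_left.2 fun y hy => ?_⟩
      obtain ⟨i, -, rfl⟩ := Finset.mem_map.1 hy
      exact (hfg i j).2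
    have := Finset.card_le_card h2
    simp only [Finset.card_map, Finset.card_univ, Fintype.card_fin] at this
    omega

theorem bipartiteArrows_sixteen :
    BipartiteArrows 8 16 (completeBipartiteGraph (Fin 2) (Fin 2))
      (completeBipartiteGraph (Fin 4) (Fin 4)) := by
  classical
  intro G _
  by_contra hcon
  rw [not_or] at hcon
  obtain ⟨h2, h4⟩ := hcon
  let c : Fin 16 → Finset (Fin 8) := fun j => Finset.univ.filter fun i => G.Adj (.inl i) (.inr j)
  refine not_sparse_of_linear (c := c) (by simp) (by simp) (fun j k hjk => ?_) fun J hJ => ?_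
  · by_contra hlt
    obtain ⟨x, hx, y, hy, hxy⟩ := Finset.one_lt_card.1 (not_le.1 hlt)
    simp only [c, Finset.mem_inter, Finset.mem_filter, Finset.mem_univ, true_and] at hx hy
    refine h2 (completeBipartiteGraph_isContained ⟨![x, y], ?_⟩ ⟨![j, k], ?_⟩ ?_)
    · intro s t; fin_cases s <;> fin_cases t <;> simp [hxy, hxy.symm]
    · intro s t; fin_cases s <;> fin_cases t <;> simp [hjk, hjk.symm]
    · intro s t; fin_cases s <;> fin_cases t <;> [exact hx.1; exact hx.2; exact hy.1; exact hy.2]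
  · by_contra hlt
    -- Four indices of J and four points outside their union span a `K_{4,4}` in the complement.
    obtain ⟨L, hLJ, hL⟩ := Finset.exists_subset_card_eq (s := J) (n := 4) (by omega)
    obtain ⟨T, hT, hTc⟩ := Finset.exists_subset_card_eq (s := (J.biUnion c)ᶜ) (n := 4)
      (by rw [Finset.card_compl, Fintype.card_fin]; omega)
    refine h4 (completeBipartiteGraph_isContained (T.orderEmbOfFin hTc).toEmbedding
      (L.orderEmbOfFin hL).toEmbedding fun i j => ⟨by simp [completeBipartiteGraph], fun hadj => ?_⟩)
    refine Finset.mem_compl.1 (hT (T.orderEmbOfFin_mem hTc i)) (Finset.mem_biUnion.2 ?_)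
    exact ⟨_, hLJ (L.orderEmbOfFin_mem hL j), Finset.mem_filter.2 ⟨Finset.mem_univ _, hadj⟩⟩

end BipartiteCopies

theorem mainTheorem2 :
    IsBipartiteRamseyNumber 8 (completeBipartiteGraph (Fin 2) (Fin 2))
      (completeBipartiteGraph (Fin 4) (Fin 4)) 16 :=
  ⟨bipartiteArrows_sixteen, fun _ hn => not_lt.1 fun hlt => not_bipartiteArrows_of_lt hlt hn⟩
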